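/- **Proposition 2.4 (Schur–Szegő).** For $A\subseteq\mathbb{C}$, call a polynomial $F\in\mathbb{C}[z]$ *$A$-nonvanishing* if either $F\equiv 0$ or $F(z)\neq 0$ for all $z\in A$. For real $\theta$ write $S[\theta]=\{z\in\mathbb{C}: z\neq 0,\ |\arg z|<\theta\}$, where $-\pi<\arg z\leq\pi$, and for $\kappa>0$ write $\kappa D=\{z\in\mathbb{C}:|z|<\kappa\}$ and $\kappa E=\{z\in\mathbb{C}:|z|>\kappa\}$. Let $d\geq 0$ be an integer, let $u_0,\dots,u_d\in\mathbb{C}$, let $P(z)=\sum_j c_jz^j\in\mathbb{C}[z]$ have degree at most $d$, and put $$K(z)=\sum_{j=0}^d\binom{d}{j}u_jz^j,\qquad Q(z)=\sum_{j=0}^d u_jc_jz^j.$$ (a) For every $0\leq\alpha<\pi/2$: if $P$ is $S[\pi/2]$-nonvanishing and $K$ is $S[\pi-\alpha]$-nonvanishing, then $Q$ is $S[\pi/2-\alpha]$-nonvanishing. (b) For all $\kappa>0$ and $\rho>0$: if $P$ is $\rho D$-nonvanishing and $K$ is $\kappa D$-nonvanishing, then $Q$ is $\kappa\rho D$-nonvanishing.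 (c) For all $\kappa>0$ and $\rho>0$: if $P$ is $\rho E$-nonvanishing, $K$ is $\kappa E$-nonvanishing, $\deg K=d$, and either $P\equiv 0$ or $\deg P=d$, then $Q$ is $\kappa\rho E$-nonvanishing. -/

import Mathlib

open Polynomial

namespace SchurSzego

/-- A complex polynomial in one variable is `A`-nonvanishing if it is identically zero or
has no zero in `A`. -/
def Nonvanishing (A : Set ℂ) (F : ℂ[X]) : Prop :=
  F = 0 ∨ ∀ z ∈ A, F.eval z ≠ 0

/-- The open sector `S[θ]` centred on the positive real axis
(`Complex.arg` takes values in `(-π, π]`). -/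
def sector (θ : ℝ) : Set ℂ :=
  {z | z ≠ 0 ∧ |Complex.arg z| < θ}

/-- The open disk `κD`. -/
def disk (κ : ℝ) : Set ℂ :=
  {z | ‖z‖ < κ}

/-- The open exterior `κE` of a disk. -/
def exterior (κ : ℝ) : Set ℂ :=
  {z | κ < ‖z‖}

/-- `K(z) = ∑_{j=0}^d (d choose j) u_j z^j`. -/
noncomputable def keyPolynomial (d : ℕ) (u : ℕ → ℂ) : ℂ[X] :=
  ∑ j ∈ Finset.range (d + 1), C ((d.choose j : ℂ) * u j) * X ^ j

/-- `Q(z) = ∑_{j=0}^d u_j c_j z^j`, where `P(z) = ∑_j c_j z^j`. -/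
noncomputable def composition (d : ℕ) (u : ℕ → ℂ) (P : ℂ[X]) : ℂ[X] :=
  ∑ j ∈ Finset.range (d + 1), C (u j * P.coeff j) * X ^ j

end SchurSzego

/-!
Fix `z` and regard `Q(z)` as a symmetric multilinear form `L` in the `d` linear factors of `P`, a
missing factor being the constant `1`, i.e. a root at infinity. On the diagonal, where all factors
equal `aX + b`, this form is `b ^ d * K(z * a / b)`. In the homogeneous coordinates `(a, b)` the
circular regions of the Riemann sphere become cones `‖f v‖ < ‖g v‖`, and the Grace–Walsh–Szegő
theorem says that a form which vanishes nowhere on the diagonal of such a cone vanishes nowhere on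
the cone.

Hörmander's proof of this theorem replaces one argument at a time. If `L(v, …, v) ≠ 0` on the cone
and `a`, `b` belong to it, then the roots of the polynomial `t ↦ L(ta + b, …, ta + b)` lie in the
convex set `{t | ta + b ∉ cone}`, which omits `0`. Hence their centroid, which is
`-L(a, …, a, b) / L(a, …, a)`, is not zero.

For disks and their exteriors the linear factors of `P` lie in a suitable open cone. For the
half-plane they lie only in its closure, and the result follows from a perturbation of the factors
and Hurwitz's theorem.
-/

namespace SchurSzego

theorem smul_sum_mem_of_convex {E : Type*} [AddCommGroup E] [Module ℝ E] {D : Set E}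
    (hD : Convex ℝ D) {s : Multiset E} (hs : s ≠ 0) (h : ∀ x ∈ s, x ∈ D) :
    (Multiset.card s : ℝ)⁻¹ • s.sum ∈ D := by
  classical
  have hcard : ∑ x ∈ s.toFinset, (s.count x : ℝ) = Multiset.card s := by
    exact_mod_cast s.toFinset_sum_count_eq
  have hpos : (0 : ℝ) < ∑ x ∈ s.toFinset, (s.count x : ℝ) := by
    rw [hcard]
    exact_mod_cast Multiset.card_pos.2 hs
  have := hD.centerMass_mem (z := id) (fun x _ => (s.count x).cast_nonneg) hpos
    fun x hx => h x (Multiset.mem_toFinset.1 hx)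
  simpa [Finset.centerMass, hcard, Finset.sum_multiset_count, Nat.cast_smul_eq_nsmul] using this

theorem nextCoeff_ne_zero_of_roots_mem_convex {k : Type*} [Field k] [Algebra ℝ k] {F : k[X]}
    (hF : F.Splits) (hdeg : F.natDegree ≠ 0) {D : Set k} (hD : Convex ℝ D) (h0 : 0 ∉ D)
    (hroots : ∀ r ∈ F.roots, r ∈ D) : F.nextCoeff ≠ 0 := by
  have hF0 : F ≠ 0 := by rintro rfl; simp at hdeg
  have hne : F.roots ≠ 0 := hF.roots_ne_zero hdeg
  rw [hF.nextCoeff_eq_neg_sum_roots_mul_leadingCoeff]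
  refine mul_ne_zero (neg_ne_zero.2 (leadingCoeff_ne_zero.2 hF0)) fun hsum => h0 ?_
  simpa [hsum] using smul_sum_mem_of_convex hD hne hroots

section KeyPolynomial

variable (d : ℕ) (u : ℕ → ℂ)

theorem keyPolynomial_eval (w : ℂ) :
    (keyPolynomial d u).eval w = ∑ j ∈ Finset.range (d + 1), (d.choose j : ℂ) * u j * w ^ j := by
  simp [keyPolynomial, eval_finsetSum]

theorem keyPolynomial_coeff {j : ℕ} (hj : j ≤ d) :
    (keyPolynomial d u).coeff j = (d.choose j : ℂ) * u j := by
  simp only [keyPolynomial, finsetSum_coeff, coeff_C_mul_X_pow]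
  rw [Finset.sum_ite_eq, if_pos (Finset.mem_range_succ_iff.2 hj)]

theorem keyPolynomial_natDegree_le : (keyPolynomial d u).natDegree ≤ d :=
  natDegree_sum_le_of_forall_le _ _ fun _ hj =>
    (natDegree_C_mul_X_pow_le _ _).trans (Finset.mem_range_succ_iff.1 hj)

theorem keyPolynomial_eval_of_linearMap {S : Type*} [CommSemiring S] [Algebra ℂ S]
    (L : S →ₗ[ℂ] ℂ) (x y : S) (t : ℂ) :
    (keyPolynomial d fun j => L (x ^ j * y ^ (d - j))).eval t = L ((t • x + y) ^ d) := by
  rw [keyPolynomial_eval, add_pow, map_sum]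
  refine Finset.sum_congr rfl fun j _ => ?_
  rw [_root_.smul_pow, smul_mul_assoc, smul_mul_assoc, map_smul, ← nsmul_eq_mul', map_nsmul,
    nsmul_eq_mul, smul_eq_mul]
  ring

end KeyPolynomial

section GraceWalshSzego

variable {V E F : Type*} [AddCommGroup V] [Module ℂ V]
  [NormedAddCommGroup E] [InnerProductSpace ℂ E] [NormedAddCommGroup F] [InnerProductSpace ℂ F]

/-- The cone of a Hermitian form of shape `‖g v‖² - ‖f v‖²`. For `V = ℂ × ℂ` with homogeneous
coordinates `(a, b) ↔ a / b`, these cones are the open disks, half-planes and exteriors of disks of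
the Riemann sphere. -/
def circularCone (f : V →ₗ[ℂ] E) (g : V →ₗ[ℂ] F) : Set V :=
  {v | ‖f v‖ < ‖g v‖}

theorem convex_setOf_norm_smul_add_le {p q : F} {r s : E} (h : ‖r‖ ≤ ‖p‖) :
    Convex ℝ {y : ℂ | ‖y • p + q‖ ≤ ‖y • r + s‖} := by
  have hsq : ∀ y : ℂ, ‖y • p + q‖ ≤ ‖y • r + s‖ ↔
      (‖p‖ ^ 2 - ‖r‖ ^ 2) * ‖y‖ ^ 2 + (2 * (inner ℂ q p - inner ℂ s r) * y).re ≤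
        ‖s‖ ^ 2 - ‖q‖ ^ 2 := by
    intro y
    rw [← sq_le_sq₀ (norm_nonneg _) (norm_nonneg _), norm_add_sq (𝕜 := ℂ), norm_add_sq (𝕜 := ℂ),
      inner_re_symm, inner_re_symm (y • r)]
    simp only [norm_smul, inner_smul_right, RCLike.re_to_complex, Complex.mul_re, Complex.sub_re,
      Complex.sub_im, Complex.mul_im, Complex.re_ofNat, Complex.im_ofNat]
    constructor <;> intro h <;> linarith
  simp only [hsq]
  have hlin : ConvexOn ℝ Set.univ fun y : ℂ => (2 * (inner ℂ q p - inner ℂ s r) * y).re :=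
    (Complex.reLm ∘ₗ LinearMap.mulLeft ℝ (2 * (inner ℂ q p - inner ℂ s r))).convexOn convex_univ
  have hquad : ConvexOn ℝ Set.univ fun y : ℂ => (‖p‖ ^ 2 - ‖r‖ ^ 2) * ‖y‖ ^ 2 :=
    (convexOn_univ_norm.pow (fun _ _ => norm_nonneg _) 2).smul
      (sub_nonneg.2 (pow_le_pow_left₀ (norm_nonneg r) h 2))
  simpa using (hquad.add hlin).convex_le (‖s‖ ^ 2 - ‖q‖ ^ 2)

variable {f : V →ₗ[ℂ] E} {g : V →ₗ[ℂ] F}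

theorem convex_setOf_smul_add_notMem_circularCone {a : V} (ha : a ∈ circularCone f g) (b : V) :
    Convex ℝ {t : ℂ | t • a + b ∉ circularCone f g} := by
  simpa [circularCone] using convex_setOf_norm_smul_add_le (q := g b) (s := f b) (le_of_lt ha)

variable {S : Type*} [CommSemiring S] [Algebra ℂ S] {ℓ : V →ₗ[ℂ] S} {L : S →ₗ[ℂ] ℂ}

theorem apply_pow_mul_ne_zero {n : ℕ} (hL : ∀ v ∈ circularCone f g, L (ℓ v ^ (n + 1)) ≠ 0)
    {a b : V} (ha : a ∈ circularCone f g) (hb : b ∈ circularCone f g) :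
    L (ℓ a ^ n * ℓ b) ≠ 0 := by
  set G := keyPolynomial (n + 1) fun j => L (ℓ a ^ j * ℓ b ^ (n + 1 - j)) with hG
  have heval : ∀ t, G.eval t = L (ℓ (t • a + b) ^ (n + 1)) := by
    simp [hG, keyPolynomial_eval_of_linearMap]
  have hdeg : G.natDegree = n + 1 := by
    refine natDegree_eq_of_le_of_coeff_ne_zero (keyPolynomial_natDegree_le _ _) ?_
    simpa [hG, keyPolynomial_coeff] using hL a ha
  have hnext : G.nextCoeff = (n + 1) * L (ℓ a ^ n * ℓ b) := by
    rw [nextCoeff_of_natDegree_pos (by omega), hdeg, Nat.add_sub_cancel,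
      keyPolynomial_coeff _ _ n.le_succ]
    simp
  have hroots : ∀ t ∈ G.roots, t • a + b ∉ circularCone f g := fun t ht hmem =>
    hL _ hmem ((heval t).symm.trans (mem_roots'.1 ht).2)
  refine right_ne_zero_of_mul (hnext ▸ nextCoeff_ne_zero_of_roots_mem_convex
    (IsAlgClosed.splits G) (by omega) (convex_setOf_smul_add_notMem_circularCone ha b) ?_ hroots)
  simpa using hb

/-- The **Grace–Walsh–Szegő theorem** in Hörmander's form. The symmetric multilinear form
is `v₁, …, vₙ ↦ L (ℓ v₁ ⋯ ℓ vₙ)`. -/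
theorem apply_prod_ne_zero_of_mem_circularCone (hne : (circularCone f g).Nonempty)
    {s : Multiset V} (hs : ∀ v ∈ s, v ∈ circularCone f g)
    (hL : ∀ v ∈ circularCone f g, L (ℓ v ^ Multiset.card s) ≠ 0) : L (s.map ℓ).prod ≠ 0 := by
  induction s using Multiset.induction_on generalizing L with
  | empty =>
    obtain ⟨v, hv⟩ := hne
    simpa using hL v hv
  | cons b s ih =>
    rw [Multiset.forall_mem_cons] at hs
    rw [Multiset.card_cons] at hL
    have := ih (L := L ∘ₗ LinearMap.mulRight ℂ (ℓ b)) hs.2 fun a ha =>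
      apply_pow_mul_ne_zero hL ha hs.1
    simpa [mul_comm] using this

end GraceWalshSzego

section LinearFactors

/-- The linear polynomial `a X + b` with homogeneous coordinates `(a, b)`; its root is `-b / a`,
which is the point at infinity for `a = 0`. -/
noncomputable def linearPolynomial : ℂ × ℂ →ₗ[ℂ] ℂ[X] :=
  (LinearMap.toSpanSingleton ℂ ℂ[X] X).coprod (LinearMap.toSpanSingleton ℂ ℂ[X] 1)

theorem linearPolynomial_apply (v : ℂ × ℂ) : linearPolynomial v = v.1 • X + v.2 • 1 := rfl

/-- Homogeneous coordinates of the linear factors of `P`, seen as a polynomial of formal degree `d`: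
the missing `d - P.natDegree` roots are placed at infinity. -/
noncomputable def linearFactors (d : ℕ) (P : ℂ[X]) : Multiset (ℂ × ℂ) :=
  P.roots.map (fun r => (1, -r)) + Multiset.replicate (d - P.natDegree) (0, 1)

variable {d : ℕ} {P : ℂ[X]}

theorem card_linearFactors (hd : P.natDegree ≤ d) : Multiset.card (linearFactors d P) = d := by
  simp only [linearFactors, Multiset.card_add, Multiset.card_map, Multiset.card_replicate,
    ← (IsAlgClosed.splits P).natDegree_eq_card_roots]
  omega

theorem leadingCoeff_smul_prod_linearFactors (d : ℕ) (P : ℂ[X]) :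
    P.leadingCoeff • ((linearFactors d P).map linearPolynomial).prod = P := by
  conv_rhs => rw [(IsAlgClosed.splits P).eq_prod_roots]
  simp [linearFactors, linearPolynomial_apply, Function.comp_def, smul_eq_C_mul, sub_eq_add_neg]

theorem forall_mem_linearFactors {p : ℂ × ℂ → Prop}
    (hroot : ∀ r, P.eval r = 0 → p (1, -r)) (hinf : P.natDegree < d → p (0, 1)) :
    ∀ v ∈ linearFactors d P, p v := by
  intro v hv
  rcases Multiset.mem_add.1 hv with hv | hv
  · obtain ⟨r, hr, rfl⟩ := Multiset.mem_map.1 hv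
    exact hroot r (mem_roots'.1 hr).2
  · obtain ⟨hpos, rfl⟩ := Multiset.mem_replicate.1 hv
    exact hinf (by omega)

end LinearFactors

section Composition

variable (d : ℕ) (u : ℕ → ℂ)

theorem composition_zero_right : composition d u 0 = 0 := by
  simp [composition]

theorem composition_natDegree_le (P : ℂ[X]) : (composition d u P).natDegree ≤ d :=
  natDegree_sum_le_of_forall_le _ _ fun _ hj =>
    (natDegree_C_mul_X_pow_le _ _).trans (Finset.mem_range_succ_iff.1 hj)

variable {d u} in
theorem composition_eq_zero_of_keyPolynomial_eq_zero (h : keyPolynomial d u = 0) (P : ℂ[X]) :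
    composition d u P = 0 := by
  refine Finset.sum_eq_zero fun j hj => ?_
  have hj' := Finset.mem_range_succ_iff.1 hj
  have hu : (d.choose j : ℂ) * u j = 0 := by rw [← keyPolynomial_coeff d u hj', h, coeff_zero]
  have : (d.choose j : ℂ) ≠ 0 := by exact_mod_cast (Nat.choose_pos hj').ne'
  simp [(mul_eq_zero.1 hu).resolve_left this]

/-- The linear functional `P ↦ Q(z)`, where `Q = composition d u P`. -/
noncomputable def compositionEval (z : ℂ) : ℂ[X] →ₗ[ℂ] ℂ :=
  ∑ j ∈ Finset.range (d + 1), (u j * z ^ j) • lcoeff ℂ j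

theorem compositionEval_apply (z : ℂ) (P : ℂ[X]) :
    compositionEval d u z P = (composition d u P).eval z := by
  simp only [compositionEval, composition, LinearMap.sum_apply, LinearMap.smul_apply, lcoeff_apply,
    smul_eq_mul, eval_finsetSum, eval_C_mul, eval_pow, eval_X]
  exact Finset.sum_congr rfl fun j _ => by ring

theorem compositionEval_X_pow {j : ℕ} (hj : j ≤ d) (z : ℂ) :
    compositionEval d u z (X ^ j) = u j * z ^ j := by
  simp only [compositionEval, LinearMap.sum_apply, LinearMap.smul_apply, lcoeff_apply, coeff_X_pow,
    smul_eq_mul, mul_ite, mul_one, mul_zero]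
  rw [Finset.sum_ite_eq', if_pos (Finset.mem_range_succ_iff.2 hj)]

theorem compositionEval_smul_X_add_one_pow (z t : ℂ) :
    compositionEval d u z ((t • X + 1) ^ d) = (keyPolynomial d u).eval (z * t) := by
  rw [← keyPolynomial_eval_of_linearMap, keyPolynomial_eval, keyPolynomial_eval]
  refine Finset.sum_congr rfl fun j hj => ?_
  rw [one_pow, mul_one, compositionEval_X_pow d u (Finset.mem_range_succ_iff.1 hj)]
  ring

theorem compositionEval_linearPolynomial_pow (z : ℂ) {v : ℂ × ℂ} (hv : v.2 ≠ 0) :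
    compositionEval d u z (linearPolynomial v ^ d) =
      v.2 ^ d * (keyPolynomial d u).eval (z * (v.1 / v.2)) := by
  have : linearPolynomial v = v.2 • ((v.1 / v.2) • X + 1) := by
    rw [linearPolynomial_apply, smul_add, smul_smul, mul_div_cancel₀ _ hv]
  rw [this, _root_.smul_pow, map_smul, compositionEval_smul_X_add_one_pow, smul_eq_mul]

theorem compositionEval_linearPolynomial_pow_of_snd_eq_zero (z : ℂ) {v : ℂ × ℂ} (hv : v.2 = 0) :
    compositionEval d u z (linearPolynomial v ^ d) = (v.1 * z) ^ d * u d := by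
  rw [linearPolynomial_apply, hv, zero_smul, add_zero, _root_.smul_pow, map_smul,
    compositionEval_X_pow d u le_rfl, smul_eq_mul]
  ring

theorem composition_eval_ne_zero {d : ℕ} {u : ℕ → ℂ} {z : ℂ} {P : ℂ[X]} (hP : P ≠ 0)
    (hd : P.natDegree ≤ d) {f g : ℂ × ℂ →ₗ[ℂ] ℂ} (hne : (circularCone f g).Nonempty)
    (hK : ∀ v ∈ circularCone f g, compositionEval d u z (linearPolynomial v ^ d) ≠ 0)
    (hroots : ∀ v ∈ linearFactors d P, v ∈ circularCone f g) :
    (composition d u P).eval z ≠ 0 := by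
  rw [← compositionEval_apply, ← leadingCoeff_smul_prod_linearFactors d P, map_smul]
  refine smul_ne_zero (leadingCoeff_ne_zero.2 hP)
    (apply_prod_ne_zero_of_mem_circularCone hne hroots ?_)
  rwa [card_linearFactors hd]

end Composition

section Disks

variable {d : ℕ} {u : ℕ → ℂ} {P : ℂ[X]} {κ ρ : ℝ}

theorem mem_circularCone_disk (hκ : 0 ≤ κ) {z : ℂ} {v : ℂ × ℂ} :
    v ∈ circularCone (z • LinearMap.fst ℂ ℂ ℂ) ((κ : ℂ) • LinearMap.snd ℂ ℂ ℂ) ↔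
      ‖z‖ * ‖v.1‖ < κ * ‖v.2‖ := by
  simp [circularCone, abs_of_nonneg hκ]

theorem mem_circularCone_exterior (hκ : 0 ≤ κ) {z : ℂ} {v : ℂ × ℂ} :
    v ∈ circularCone ((κ : ℂ) • LinearMap.snd ℂ ℂ ℂ) (z • LinearMap.fst ℂ ℂ ℂ) ↔
      κ * ‖v.2‖ < ‖z‖ * ‖v.1‖ := by
  simp [circularCone, abs_of_nonneg hκ]

theorem nonvanishing_disk_composition (hd : P.natDegree ≤ d) (hκ : 0 < κ)
    (hP : Nonvanishing (disk ρ) P) (hK : Nonvanishing (disk κ) (keyPolynomial d u)) :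
    Nonvanishing (disk (κ * ρ)) (composition d u P) := by
  by_cases hP0 : P = 0
  · exact Or.inl (hP0 ▸ composition_zero_right d u)
  rcases hK with hK | hK
  · exact Or.inl (composition_eq_zero_of_keyPolynomial_eq_zero hK P)
  refine Or.inr fun z (hz : ‖z‖ < κ * ρ) => ?_
  have hinf : (0, 1) ∈ circularCone (z • LinearMap.fst ℂ ℂ ℂ) ((κ : ℂ) • LinearMap.snd ℂ ℂ ℂ) :=
    (mem_circularCone_disk hκ.le).2 (by simpa using hκ)
  refine composition_eval_ne_zero hP0 hd ⟨_, hinf⟩ (fun v hv => ?_)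
    (forall_mem_linearFactors (fun r hr => ?_) fun _ => hinf)
  · rw [mem_circularCone_disk hκ.le] at hv
    have hv2 : 0 < ‖v.2‖ := pos_of_mul_pos_right
      ((mul_nonneg (norm_nonneg _) (norm_nonneg _)).trans_lt hv) hκ.le
    rw [compositionEval_linearPolynomial_pow d u z (norm_pos_iff.1 hv2)]
    refine mul_ne_zero (pow_ne_zero _ (norm_pos_iff.1 hv2)) (hK _ ?_)
    change ‖z * (v.1 / v.2)‖ < κ
    rwa [norm_mul, norm_div, ← mul_div_assoc, div_lt_iff₀ hv2]
  · have hrρ : ρ ≤ ‖r‖ := not_lt.1 fun h => hP.resolve_left hP0 r h hr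
    rw [mem_circularCone_disk hκ.le, norm_one, mul_one, norm_neg]
    exact hz.trans_le (mul_le_mul_of_nonneg_left hrρ hκ.le)

theorem nonvanishing_exterior_composition (hd : P.natDegree = d)
    (hKd : (keyPolynomial d u).natDegree = d) (hκ : 0 ≤ κ) (hρ : 0 ≤ ρ)
    (hP : Nonvanishing (exterior ρ) P) (hK : Nonvanishing (exterior κ) (keyPolynomial d u)) :
    Nonvanishing (exterior (κ * ρ)) (composition d u P) := by
  by_cases hP0 : P = 0
  · exact Or.inl (hP0 ▸ composition_zero_right d u)
  by_cases hK0 : keyPolynomial d u = 0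
  · exact Or.inl (composition_eq_zero_of_keyPolynomial_eq_zero hK0 P)
  refine Or.inr fun z (hz : κ * ρ < ‖z‖) => ?_
  have hz0 : 0 < ‖z‖ := (mul_nonneg hκ hρ).trans_lt hz
  have hu : u d ≠ 0 := by
    have := leadingCoeff_ne_zero.2 hK0
    rw [leadingCoeff, hKd, keyPolynomial_coeff d u le_rfl] at this
    exact right_ne_zero_of_mul this
  refine composition_eval_ne_zero hP0 hd.le
    ⟨(1, 0), (mem_circularCone_exterior hκ).2 (by simpa using hz0)⟩ (fun v hv => ?_)
    (forall_mem_linearFactors (fun r hr => ?_) fun hlt => absurd hd hlt.ne)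
  · rw [mem_circularCone_exterior hκ] at hv
    by_cases hv2 : v.2 = 0
    · have hv1 : 0 < ‖v.1‖ := pos_of_mul_pos_right
        ((mul_nonneg hκ (norm_nonneg _)).trans_lt hv) hz0.le
      rw [compositionEval_linearPolynomial_pow_of_snd_eq_zero d u z hv2]
      exact mul_ne_zero (pow_ne_zero _ (mul_ne_zero (norm_pos_iff.1 hv1) (norm_pos_iff.1 hz0))) hu
    · rw [compositionEval_linearPolynomial_pow d u z hv2]
      refine mul_ne_zero (pow_ne_zero _ hv2) (hK.resolve_left hK0 _ ?_)
      change κ < ‖z * (v.1 / v.2)‖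
      rwa [norm_mul, norm_div, ← mul_div_assoc, lt_div_iff₀ (norm_pos_iff.2 hv2)]
  · have hrρ : ‖r‖ ≤ ρ := not_lt.1 fun h => hP.resolve_left hP0 r h hr
    rw [mem_circularCone_exterior hκ, norm_one, mul_one, norm_neg]
    exact (mul_le_mul_of_nonneg_left hrρ hκ).trans_lt hz

end Disks

section Hurwitz

theorem norm_eval_le_of_forall_roots {k : Type*} [NormedField k] {F : k[X]} (hF : F.Splits)
    {z₀ z : k} (h : ∀ r ∈ F.roots, ‖z - z₀‖ ≤ ‖z₀ - r‖) :
    ‖F.eval z‖ ≤ 2 ^ F.natDegree * ‖F.eval z₀‖ := by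
  have hnorm : ∀ w, ‖F.eval w‖ = ‖F.leadingCoeff‖ * (F.roots.map fun r => ‖w - r‖).prod := by
    intro w
    rw [hF.eval_eq_prod_roots, norm_mul, ← normHom_apply (Multiset.prod _), map_multiset_prod,
      Multiset.map_map]
    rfl
  have hprod : (F.roots.map fun r => ‖z - r‖).prod ≤
      (F.roots.map fun r => 2 * ‖z₀ - r‖).prod := by
    refine Multiset.prod_map_le_prod_map₀ _ _ (fun _ _ => norm_nonneg _) fun r hr => ?_
    linarith [norm_sub_le_norm_sub_add_norm_sub z z₀ r, h r hr]
  rw [Multiset.prod_map_mul, Multiset.map_const', Multiset.prod_replicate,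
    ← hF.natDegree_eq_card_roots] at hprod
  rw [hnorm, hnorm, mul_left_comm]
  exact mul_le_mul_of_nonneg_left hprod (norm_nonneg _)

/-- **Hurwitz's theorem** for polynomials of bounded degree. -/
theorem Nonvanishing.of_tendsto {ι : Type*} {l : Filter ι} [l.NeBot] {d : ℕ} {F : ι → ℂ[X]}
    {G : ℂ[X]} {U : Set ℂ} (hU : IsOpen U) (hd : ∀ᶠ i in l, (F i).natDegree ≤ d)
    (hF : ∀ᶠ i in l, ∀ z ∈ U, (F i).eval z ≠ 0)
    (hlim : ∀ z, Filter.Tendsto (fun i => (F i).eval z) l (nhds (G.eval z))) :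
    Nonvanishing U G := by
  refine or_iff_not_imp_right.2 fun hG => ?_
  push Not at hG
  obtain ⟨z₀, hz₀, hGz₀⟩ := hG
  obtain ⟨δ, hδ, hball⟩ := Metric.isOpen_iff.1 hU z₀ hz₀
  have hbound : ∀ z ∈ Metric.ball z₀ δ, ‖G.eval z‖ ≤ 2 ^ d * ‖G.eval z₀‖ := by
    intro z hz
    refine le_of_tendsto_of_tendsto (hlim z).norm ((hlim z₀).norm.const_mul _) ?_
    filter_upwards [hd, hF] with i hdi hFi
    refine (norm_eval_le_of_forall_roots (IsAlgClosed.splits _) fun r hr => ?_).trans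
      (mul_le_mul_of_nonneg_right (pow_le_pow_right₀ one_le_two hdi) (norm_nonneg _))
    have hr' : δ ≤ dist r z₀ := not_lt.1 fun h => hFi r (hball h) (mem_roots'.1 hr).2
    rw [← dist_eq_norm, ← dist_eq_norm, dist_comm z₀]
    exact (Metric.mem_ball.1 hz).le.trans hr'
  refine eq_zero_of_infinite_isRoot G (Set.Infinite.mono (fun z hz => ?_)
    (infinite_of_mem_nhds z₀ (Metric.ball_mem_nhds z₀ hδ)))
  simpa [hGz₀] using hbound z hz

theorem continuous_apply_prod_add_smul {ι R S : Type*} [CommSemiring R] [TopologicalSpace R]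
    [IsTopologicalSemiring R] [CommSemiring S] [Algebra R S] (L : S →ₗ[R] R) (x y : ι → S)
    (s : Multiset ι) : Continuous fun t : R => L (s.map fun i => x i + t • y i).prod := by
  induction s using Multiset.induction_on generalizing L with
  | empty => simpa using continuous_const
  | cons i s ih =>
    have hx := ih (L ∘ₗ LinearMap.mulLeft R (x i))
    have hy := ih (L ∘ₗ LinearMap.mulLeft R (y i))
    exact (hx.add (continuous_id.mul hy)).congr fun t => by simp [add_mul]

end Hurwitz

section Sectors

theorem mem_sector_iff_angle {θ : ℝ} {z : ℂ} :
    z ∈ sector θ ↔ z ≠ 0 ∧ InnerProductGeometry.angle 1 z < θ :=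
  and_congr_right fun hz => by rw [Complex.angle_one_left hz]

theorem isOpen_sector (θ : ℝ) : IsOpen (sector θ) := by
  refine isOpen_iff_mem_nhds.2 fun z hz => ?_
  obtain ⟨hz0, hzθ⟩ := mem_sector_iff_angle.1 hz
  have hcont : ContinuousAt (InnerProductGeometry.angle 1) z :=
    ContinuousAt.comp (f := fun w : ℂ => ((1 : ℂ), w))
      (InnerProductGeometry.continuousAt_angle one_ne_zero hz0) (by fun_prop)
  filter_upwards [isOpen_ne.mem_nhds hz0, hcont.eventually_lt_const hzθ] with w h1 h2
  exact mem_sector_iff_angle.2 ⟨h1, h2⟩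

theorem mul_mem_sector {θ φ : ℝ} {z w : ℂ} (hz : z ∈ sector θ) (hw : w ∈ sector φ) :
    z * w ∈ sector (θ + φ) := by
  rw [mem_sector_iff_angle] at *
  refine ⟨mul_ne_zero hz.1 hw.1, ?_⟩
  have := InnerProductGeometry.angle_le_angle_add_angle 1 z (z * w)
  have hrot : InnerProductGeometry.angle z (z * w) = InnerProductGeometry.angle 1 w := by
    simpa using Complex.angle_mul_left hz.1 1 w
  linarith [hz.2, hw.2]

theorem mem_sector_pi_div_two {z : ℂ} : z ∈ sector (Real.pi / 2) ↔ ‖z - 1‖ < ‖z + 1‖ := by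
  have hre : z ∈ sector (Real.pi / 2) ↔ 0 < z.re := by
    simp only [sector, Set.mem_ofPred_eq, Complex.abs_arg_lt_pi_div_two_iff]
    refine ⟨fun h => h.2.resolve_right h.1, fun h => ⟨?_, Or.inl h⟩⟩
    rintro rfl
    exact lt_irrefl _ h
  rw [hre, ← sq_lt_sq₀ (norm_nonneg _) (norm_nonneg _), Complex.sq_norm, Complex.sq_norm,
    Complex.normSq_sub, Complex.normSq_add, map_one, map_one, mul_one]
  constructor <;> intro h <;> linarith

/-- The cone of the half-plane `0 < re (a / b)` in homogeneous coordinates `(a, b)`. -/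
def rightCone : Set (ℂ × ℂ) :=
  circularCone (LinearMap.fst ℂ ℂ ℂ - LinearMap.snd ℂ ℂ ℂ)
    (LinearMap.fst ℂ ℂ ℂ + LinearMap.snd ℂ ℂ ℂ)

theorem mem_rightCone {v : ℂ × ℂ} : v ∈ rightCone ↔ ‖v.1 - v.2‖ < ‖v.1 + v.2‖ := Iff.rfl

theorem add_smul_swap_mem_rightCone {v : ℂ × ℂ} (hv0 : v ≠ 0)
    (hv : ‖v.1 - v.2‖ ≤ ‖v.1 + v.2‖) {t : ℝ} (ht : 0 < t) :
    v + (t : ℂ) • v.swap ∈ rightCone := by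
  have hsum : v.1 + v.2 ≠ 0 := by
    intro h
    have hsub : v.1 - v.2 = 0 := by simpa [h] using hv
    refine hv0 (Prod.ext ?_ ?_)
    · simpa using (by linear_combination (h + hsub) / 2 : v.1 = 0)
    · simpa using (by linear_combination (h - hsub) / 2 : v.2 = 0)
  have ht' : ‖(1 - t : ℂ)‖ < ‖(1 + t : ℂ)‖ := by
    norm_cast
    rw [Real.norm_eq_abs, Real.norm_eq_abs, ← sq_lt_sq]
    linarith
  rw [mem_rightCone]
  calc ‖(v + (t : ℂ) • v.swap).1 - (v + (t : ℂ) • v.swap).2‖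
      = ‖(1 - t : ℂ)‖ * ‖v.1 - v.2‖ := by rw [← norm_mul]; congr 1; simp; ring
    _ ≤ ‖(1 - t : ℂ)‖ * ‖v.1 + v.2‖ := mul_le_mul_of_nonneg_left hv (norm_nonneg _)
    _ < ‖(1 + t : ℂ)‖ * ‖v.1 + v.2‖ := mul_lt_mul_of_pos_right ht' (norm_pos_iff.2 hsum)
    _ = ‖(v + (t : ℂ) • v.swap).1 + (v + (t : ℂ) • v.swap).2‖ := by
      rw [← norm_mul]; congr 1; simp; ring

variable {d : ℕ} {u : ℕ → ℂ} {P : ℂ[X]} {α : ℝ}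

theorem compositionEval_linearPolynomial_pow_ne_zero_of_mem_rightCone
    (hK : ∀ w ∈ sector (Real.pi - α), (keyPolynomial d u).eval w ≠ 0) {z : ℂ}
    (hz : z ∈ sector (Real.pi / 2 - α)) {v : ℂ × ℂ} (hv : v ∈ rightCone) :
    compositionEval d u z (linearPolynomial v ^ d) ≠ 0 := by
  rw [mem_rightCone] at hv
  have hv2 : v.2 ≠ 0 := fun h => by simp [h] at hv
  have hquot : v.1 / v.2 ∈ sector (Real.pi / 2) := by
    rwa [mem_sector_pi_div_two, div_sub_one hv2, div_add_one hv2, norm_div, norm_div,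
      div_lt_div_iff_of_pos_right (norm_pos_iff.2 hv2)]
  have hmul : z * (v.1 / v.2) ∈ sector (Real.pi - α) := by
    convert mul_mem_sector hz hquot using 2
    ring
  rw [compositionEval_linearPolynomial_pow d u z hv2]
  exact mul_ne_zero (pow_ne_zero _ hv2) (hK _ hmul)

theorem add_smul_swap_mem_rightCone_of_mem_linearFactors
    (hP : ∀ z ∈ sector (Real.pi / 2), P.eval z ≠ 0) {t : ℝ} (ht : 0 < t) :
    ∀ v ∈ linearFactors d P, v + (t : ℂ) • v.swap ∈ rightCone := by
  refine forall_mem_linearFactors (fun r hr => ?_) fun _ => ?_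
  · refine add_smul_swap_mem_rightCone (by simp) ?_ ht
    have := not_lt.1 (mt mem_sector_pi_div_two.2 fun hmem => hP r hmem hr)
    rwa [sub_neg_eq_add, ← sub_eq_add_neg, add_comm, norm_sub_rev]
  · exact add_smul_swap_mem_rightCone (by simp) (by simp) ht

/-- The perturbation of `P` that replaces each linear factor `a X + b` by
`(a + t b) X + (b + t a)`. For `t > 0` it moves the roots of `P` on the imaginary axis, and
those at infinity, into the open left half-plane. -/
noncomputable def rootPerturbation (d : ℕ) (P : ℂ[X]) (t : ℝ) : ℂ[X] :=
  P.leadingCoeff •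
    (((linearFactors d P).map fun v => v + (t : ℂ) • v.swap).map linearPolynomial).prod

theorem rootPerturbation_zero (d : ℕ) (P : ℂ[X]) : rootPerturbation d P 0 = P := by
  simpa [rootPerturbation] using leadingCoeff_smul_prod_linearFactors d P

theorem continuous_composition_rootPerturbation_eval (d : ℕ) (u : ℕ → ℂ) (P : ℂ[X]) (z : ℂ) :
    Continuous fun t => (composition d u (rootPerturbation d P t)).eval z := by
  have hprod := (continuous_apply_prod_add_smul (compositionEval d u z) linearPolynomial
    (fun v => linearPolynomial v.swap) (linearFactors d P)).comp Complex.continuous_ofReal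
  refine (hprod.const_mul P.leadingCoeff).congr fun t => ?_
  rw [← compositionEval_apply, rootPerturbation, map_smul, Multiset.map_map, smul_eq_mul]
  simp only [Function.comp_def, map_add, map_smul]

theorem composition_rootPerturbation_eval_ne_zero (hP0 : P ≠ 0) (hd : P.natDegree ≤ d)
    (hP : ∀ z ∈ sector (Real.pi / 2), P.eval z ≠ 0)
    (hK : ∀ w ∈ sector (Real.pi - α), (keyPolynomial d u).eval w ≠ 0) {z : ℂ}
    (hz : z ∈ sector (Real.pi / 2 - α)) {t : ℝ} (ht : 0 < t) :
    (composition d u (rootPerturbation d P t)).eval z ≠ 0 := by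
  rw [← compositionEval_apply, rootPerturbation, map_smul]
  refine smul_ne_zero (leadingCoeff_ne_zero.2 hP0) (apply_prod_ne_zero_of_mem_circularCone
    ⟨(1, 1), mem_rightCone.2 (by norm_num)⟩ (Multiset.forall_mem_map_iff.2
      (add_smul_swap_mem_rightCone_of_mem_linearFactors hP ht)) fun v hv => ?_)
  rw [Multiset.card_map, card_linearFactors hd]
  exact compositionEval_linearPolynomial_pow_ne_zero_of_mem_rightCone hK hz hv

theorem nonvanishing_sector_composition (hd : P.natDegree ≤ d)
    (hP : Nonvanishing (sector (Real.pi / 2)) P)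
    (hK : Nonvanishing (sector (Real.pi - α)) (keyPolynomial d u)) :
    Nonvanishing (sector (Real.pi / 2 - α)) (composition d u P) := by
  by_cases hP0 : P = 0
  · exact Or.inl (hP0 ▸ composition_zero_right d u)
  rcases hK with hK | hK
  · exact Or.inl (composition_eq_zero_of_keyPolynomial_eq_zero hK P)
  refine Nonvanishing.of_tendsto (l := nhdsWithin 0 (Set.Ioi (0 : ℝ)))
    (F := fun t => composition d u (rootPerturbation d P t)) (isOpen_sector _)
    (.of_forall fun t => composition_natDegree_le d u _) ?_ fun z => ?_
  · filter_upwards [self_mem_nhdsWithin] with t ht z hz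
    exact composition_rootPerturbation_eval_ne_zero hP0 hd (hP.resolve_left hP0) hK hz ht
  · have := (continuous_composition_rootPerturbation_eval d u P z).tendsto 0
    rw [rootPerturbation_zero] at this
    exact this.mono_left nhdsWithin_le_nhds

end Sectors

end SchurSzego

theorem proposition2p4 (d : ℕ) (u : ℕ → ℂ) (P K Q : Polynomial ℂ)
    (hP : P.natDegree ≤ d)
    (hK : K = SchurSzego.keyPolynomial d u)
    (hQ : Q = SchurSzego.composition d u P) :
    (∀ α : ℝ, 0 ≤ α → α < Real.pi / 2 →
      SchurSzego.Nonvanishing (SchurSzego.sector (Real.pi / 2)) P →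
      SchurSzego.Nonvanishing (SchurSzego.sector (Real.pi - α)) K →
      SchurSzego.Nonvanishing (SchurSzego.sector (Real.pi / 2 - α)) Q) ∧
    (∀ κ ρ : ℝ, 0 < κ → 0 < ρ →
      SchurSzego.Nonvanishing (SchurSzego.disk ρ) P →
      SchurSzego.Nonvanishing (SchurSzego.disk κ) K →
      SchurSzego.Nonvanishing (SchurSzego.disk (κ * ρ)) Q) ∧
    (∀ κ ρ : ℝ, 0 < κ → 0 < ρ →
      SchurSzego.Nonvanishing (SchurSzego.exterior ρ) P →
      SchurSzego.Nonvanishing (SchurSzego.exterior κ) K →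
      (P = 0 ∨ P.natDegree = d) →
      K.natDegree = d →
      SchurSzego.Nonvanishing (SchurSzego.exterior (κ * ρ)) Q) := by
  subst hK hQ
  refine ⟨fun α _ _ hPs hKs => SchurSzego.nonvanishing_sector_composition hP hPs hKs,
    fun κ ρ hκ _ hPs hKs => SchurSzego.nonvanishing_disk_composition hP hκ hPs hKs,
    fun κ ρ hκ hρ hPs hKs hPd hKd => ?_⟩
  rcases hPd with rfl | hPd
  · exact Or.inl (SchurSzego.composition_zero_right d u)
  · exact SchurSzego.nonvanishing_exterior_composition hPd hKd hκ.le hρ.le hPs hKs
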